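/- Let $X \neq \{0\}$ be a real Banach space with closed unit ball $B_X$ and unit sphere $S_X$, and let $B(x,\rho)$ denote the closed ball of centre $x$ and radius $\rho$. A slice of $B_X$ is a set $\{y \in B_X : x^*(y) > 1-\alpha\}$ with $x^* \in X^*$, $\|x^*\| = 1$ and $\alpha > 0$; a convex combination of relatively weakly open subsets of $B_X$ is a set $\sum_{i=1}^n \lambda_i W_i$ with $n \in \mathbb{N}$, $\lambda_i \in [0,1]$, $\sum_{i=1}^n \lambda_i = 1$ and each $W_i$ relatively weakly open in $B_X$. Define the Daugavet indices of thickness $$\mathcal{T}^{s}(X) = \inf\{\rho > 0 : \text{there are } x \in S_X \text{ and a slice } S \text{ of } B_X \text{ with } S \subset B(x,\rho)\},$$ $$\mathcal{T}(X) = \inf\{\rho > 0 : \text{there are } x \in S_X \text{ and a relatively weakly open } W \text{ in } B_X \text{ with } \emptyset \neq W \subset B(x,\rho)\},$$ $$\mathcal{T}^{cc}(X) = \inf\{\rho > 0 : \text{there are } x \in S_X \text{ and a convex combination } C \text{ of relatively weakly open subsets of } B_X \text{ with } \emptyset \neq C \subset B(x,\rho)\}.$$ **Theorem.** For every $r \in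 [0,2]$ there exists a real Banach space $X \neq \{0\}$ such that $\mathcal{T}^{s}(X) = \mathcal{T}(X) = \mathcal{T}^{cc}(X) = r$. -/

import Mathlib

/-- `S` is a slice of the closed unit ball of `X`. -/
def IsSlice {X : Type*} [NormedAddCommGroup X] [NormedSpace ℝ X] (S : Set X) : Prop :=
  ∃ (f : StrongDual ℝ X) (α : ℝ), ‖f‖ = 1 ∧ 0 < α ∧
    S = {x : X | x ∈ Metric.closedBall (0 : X) 1 ∧ 1 - α < f x}

/-- `W` is a relatively weakly open subset of the closed unit ball of `X`. -/
def IsRelWeaklyOpen {X : Type*} [NormedAddCommGroup X] [NormedSpace ℝ X] (W : Set X) : Prop :=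
  ∃ V : Set (WeakSpace ℝ X), IsOpen V ∧
    W = {x : X | x ∈ Metric.closedBall (0 : X) 1 ∧ toWeakSpace ℝ X x ∈ V}

/-- `C` is a finite convex combination `∑ i, t i • W i` of relatively weakly open subsets of the
closed unit ball of `X`. -/
def IsConvexCombRelWeaklyOpen {X : Type*} [NormedAddCommGroup X] [NormedSpace ℝ X]
    (C : Set X) : Prop :=
  ∃ (n : ℕ) (t : Fin n → ℝ) (W : Fin n → Set X),
    (∀ i, 0 ≤ t i) ∧ ∑ i, t i = 1 ∧ (∀ i, IsRelWeaklyOpen (W i)) ∧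
    C = {y : X | ∃ w : Fin n → X, (∀ i, w i ∈ W i) ∧ y = ∑ i, t i • w i}

/-- The Daugavet index of thickness `𝒯(X)`. For `X ≠ 0` the set of radii contains `2`, so the
infimum is a genuine one. -/
noncomputable def daugavetIndex (X : Type*) [NormedAddCommGroup X] [NormedSpace ℝ X] : ℝ :=
  sInf {r : ℝ | 0 < r ∧ ∃ x ∈ Metric.sphere (0 : X) 1, ∃ W : Set X,
    IsRelWeaklyOpen W ∧ W.Nonempty ∧ W ⊆ Metric.closedBall x r}

/-- The slice version `𝒯ˢ(X)` of the Daugavet index of thickness (slices are nonempty, as their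
functionals have norm one). -/
noncomputable def daugavetIndexSlice (X : Type*) [NormedAddCommGroup X] [NormedSpace ℝ X] : ℝ :=
  sInf {r : ℝ | 0 < r ∧ ∃ x ∈ Metric.sphere (0 : X) 1, ∃ S : Set X,
    IsSlice S ∧ S ⊆ Metric.closedBall x r}

/-- The convex combination version `𝒯ᶜᶜ(X)` of the Daugavet index of thickness. -/
noncomputable def daugavetIndexConvComb (X : Type*) [NormedAddCommGroup X] [NormedSpace ℝ X] :
    ℝ :=
  sInf {r : ℝ | 0 < r ∧ ∃ x ∈ Metric.sphere (0 : X) 1, ∃ C : Set X,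
    IsConvexCombRelWeaklyOpen C ∧ C.Nonempty ∧ C ⊆ Metric.closedBall x r}

/-! Slices are weakly open and weakly open sets are convex combinations, so a slice bounds all three
indices above and `daugavetIndices_eq` reduces the claim to that bound and a lower bound for convex
combinations. The lower bound comes from bumps in `ℝ →ᵇ ℝ`: multiplying by disjoint bumps is weakly
null, so weakly negligible changes can raise norms and push a convex combination away from any given
function (`exists_seq_tendsto_le_norm_sub`). The norm of a sum limits how far this can go. For `r ≤
1`, add a line, with norm `max (‖y‖ + (1 - r)|z|) |z|`: every `z` leaves room for `‖y‖ = r`, and `z`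
near `1` leaves hardly more. For `r = 1 + κ > 1`, take two copies, with norm `max (‖y‖ + κ‖z‖) (κ‖y‖
+ ‖z‖)`: perturbing both makes the coordinate distances sum to almost `2`, and averaging the two
expressions gives `1 + κ`. -/

open Filter Topology BoundedContinuousFunction

/-! ### Weak perturbations in `ℝ →ᵇ ℝ` -/

/-- Arbitrarily close to any real number there are infinitely many disjointly supported bumps. -/
theorem exists_disjoint_bumps (τ δ : ℝ) (hδ : 0 < δ) :
    ∃ (φ : ℕ → ℝ →ᵇ ℝ) (p : ℕ → ℝ), (∀ k x, 0 ≤ φ k x ∧ φ k x ≤ 1) ∧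
      (∀ k, φ k (p k) = 1 ∧ |p k - τ| < δ) ∧ ∀ j k x, j ≠ k → φ j x * φ k x = 0 := by
  -- Tents centred at `τ + d k` with half-width `d k / 4`: since `d` halves at each step, their
  -- supports are disjoint.
  set d : ℕ → ℝ := fun k => δ / 2 ^ (k + 1) with hd
  have hd0 : ∀ k, 0 < d k := fun k => by positivity
  set g : ℕ → ℝ → ℝ := fun k x => max 0 (1 - |x - τ - d k| / (d k / 4)) with hg
  have hg0 : ∀ k x, 0 ≤ g k x := fun k x => le_max_left _ _
  have hg1 : ∀ k x, g k x ≤ 1 := fun k x => by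
    have := hd0 k
    refine max_le zero_le_one ?_
    have : 0 ≤ |x - τ - d k| / (d k / 4) := by positivity
    linarith
  have hgc : ∀ k, Continuous (g k) := fun k => by
    simp only [hg]
    fun_prop
  have hsupp : ∀ k x, g k x ≠ 0 → |x - τ - d k| < d k / 4 := fun k x h => by
    by_contra! hc
    have := hd0 k
    refine h (max_eq_left ?_)
    have : 1 ≤ |x - τ - d k| / (d k / 4) := (one_le_div (by positivity)).2 hc
    linarith
  have hdisj : ∀ j k x, j < k → g j x * g k x = 0 := fun j k x hjk => by
    by_contra h
    have h1 := abs_lt.1 (hsupp j x (left_ne_zero_of_mul h))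
    have h2 := abs_lt.1 (hsupp k x (right_ne_zero_of_mul h))
    have h3 : d k ≤ d j / 2 := by
      simp only [hd]
      rw [div_div, ← pow_succ]
      exact div_le_div_of_nonneg_left hδ.le (by positivity)
        (pow_le_pow_right₀ one_le_two (by omega))
    have := hd0 j
    linarith [h1.1, h2.2]
  refine ⟨fun k => BoundedContinuousFunction.ofNormedAddCommGroup (g k) (hgc k) 1 fun x => ?_,
    fun k => τ + d k, fun k x => ⟨hg0 k x, hg1 k x⟩, fun k => ⟨?_, ?_⟩, fun j k x hjk => ?_⟩
  · rw [Real.norm_of_nonneg (hg0 k x)]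
    exact hg1 k x
  · simp [hg]
  · rw [add_sub_cancel_left, abs_of_pos (hd0 k)]
    exact div_lt_self hδ (one_lt_pow₀ one_lt_two (by omega))
  · rcases lt_or_gt_of_ne hjk with h | h
    · exact hdisj j k x h
    · rw [mul_comm]
      exact hdisj k j x h

/-- Multiplying by disjointly supported bumps gives a weakly null sequence. -/
theorem tendsto_apply_disjoint_mul {φ : ℕ → ℝ →ᵇ ℝ} (h01 : ∀ k x, 0 ≤ φ k x ∧ φ k x ≤ 1)
    (hdisj : ∀ j k x, j ≠ k → φ j x * φ k x = 0) (g : ℝ →ᵇ ℝ) (f : StrongDual ℝ (ℝ →ᵇ ℝ)) :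
    Tendsto (fun k => f (φ k * g)) atTop (𝓝 0) := by
  -- At each point at most one term survives, so the bound does not depend on `s`; choosing signs
  -- then makes `f (φ k * g)` absolutely summable.
  have hbound : ∀ (s : Finset ℕ) (c : ℕ → ℝ), (∀ k, |c k| ≤ 1) →
      ‖∑ k ∈ s, c k • (φ k * g)‖ ≤ ‖g‖ := fun s c hc => by
    refine (norm_le (norm_nonneg g)).2 fun x => ?_
    have hx : (∑ k ∈ s, c k • (φ k * g)) x = ∑ k ∈ s, c k * (φ k x * g x) := by
      simp [BoundedContinuousFunction.sum_apply]
    rw [hx]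
    by_cases h : ∃ j ∈ s, φ j x ≠ 0
    · obtain ⟨j, hj, hjx⟩ := h
      rw [Finset.sum_eq_single_of_mem j hj fun k _ hk => by
        rw [(mul_eq_zero.1 (hdisj j k x hk.symm)).resolve_left hjx]; ring]
      rw [norm_mul, norm_mul, Real.norm_eq_abs, Real.norm_of_nonneg (h01 j x).1]
      calc |c j| * (φ j x * ‖g x‖) ≤ 1 * (1 * ‖g x‖) :=
            mul_le_mul (hc j) (mul_le_mul_of_nonneg_right (h01 j x).2 (norm_nonneg _))
              (mul_nonneg (h01 j x).1 (norm_nonneg _)) zero_le_one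
        _ ≤ ‖g‖ := by simpa using g.norm_coe_le_norm x
    · push Not at h
      rw [Finset.sum_eq_zero fun k hk => by rw [h k hk]; ring]
      simp
  have hsum : Summable fun k => |f (φ k * g)| := by
    refine summable_of_sum_le (c := ‖f‖ * ‖g‖) (fun k => abs_nonneg _) fun s => ?_
    have hs := hbound s (fun k => SignType.sign (f (φ k * g))) fun k => by
      rcases lt_trichotomy (f (φ k * g)) 0 with h | h | h <;> simp [h]
    calc ∑ k ∈ s, |f (φ k * g)|
        = f (∑ k ∈ s, ((SignType.sign (f (φ k * g)) : SignType) : ℝ) • (φ k * g)) := by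
          simp [map_sum, sign_mul_self]
      _ ≤ ‖f‖ * ‖g‖ := (le_abs_self _).trans
          ((f.le_opNorm _).trans (mul_le_mul_of_nonneg_left hs (norm_nonneg _)))
  exact (tendsto_zero_iff_abs_tendsto_zero _).2 hsum.tendsto_atTop_zero

/-- A quantitative form of the Daugavet property of `ℝ →ᵇ ℝ`: finitely many functions can be
perturbed simultaneously along weakly convergent sequences so that their convex combination
becomes almost `ℓ₁`-orthogonal to a prescribed function. -/
theorem exists_seq_tendsto_le_norm_sub {ι : Type*} [Fintype ι] (t : ι → ℝ) (y : ι → ℝ →ᵇ ℝ)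
    (R : ι → ℝ) (hR : ∀ i, ‖y i‖ ≤ R i) (y₀ : ℝ →ᵇ ℝ) {ε : ℝ} (hε : 0 < ε) :
    ∃ u : ℕ → ι → ℝ →ᵇ ℝ,
      (∀ i (f : StrongDual ℝ (ℝ →ᵇ ℝ)), Tendsto (fun k => f (u k i)) atTop (𝓝 (f (y i)))) ∧
      (∀ k i, ‖u k i‖ ≤ R i) ∧
      ∀ k, ‖y₀‖ + ∑ i, t i * R i - ε ≤ ‖∑ i, t i • u k i - y₀‖ := by
  obtain ⟨τ, hτ⟩ : ∃ τ, ‖y₀‖ - ε / 2 ≤ |y₀ τ| := by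
    by_contra! h
    have h0 := (abs_nonneg _).trans (h 0).le
    have := (norm_le (f := y₀) h0).2 fun x => (h x).le
    linarith
  obtain ⟨s, hs, hsτ⟩ : ∃ s : ℝ, |s| = 1 ∧ s * y₀ τ = |y₀ τ| := by
    rcases le_total 0 (y₀ τ) with h | h
    · exact ⟨1, by simp, by rw [abs_of_nonneg h, one_mul]⟩
    · exact ⟨-1, by simp, by rw [abs_of_nonpos h, neg_one_mul]⟩
  obtain ⟨δ, hδ, hδy⟩ := Metric.continuousAt_iff.1 y₀.continuous.continuousAt (ε / 2) (half_pos hε)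
  obtain ⟨φ, p, h01, hp, hdisj⟩ := exists_disjoint_bumps τ δ hδ
  -- At the peak `p k`, near where `|y₀|` almost attains its norm, every function takes the value
  -- `-s * R i`, of sign opposite to `y₀`. Elsewhere the values are convex combinations of `y i` and
  -- this constant, so `R i` still bounds them.
  refine ⟨fun k i => y i + φ k * (BoundedContinuousFunction.const ℝ (-s * R i) - y i),
    fun i f => ?_, fun k i => ?_, fun k => ?_⟩
  · simpa using (tendsto_apply_disjoint_mul h01 hdisj
      (BoundedContinuousFunction.const ℝ (-s * R i) - y i) f).const_add (f (y i))
  · refine (norm_le ((norm_nonneg _).trans (hR i))).2 fun x => ?_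
    obtain ⟨h0, h1⟩ := h01 k x
    have hy : |y i x| ≤ R i := ((y i).norm_coe_le_norm x).trans (hR i)
    have hsR : |s * R i| ≤ R i := by
      rw [abs_mul, hs, one_mul, abs_of_nonneg ((norm_nonneg _).trans (hR i))]
    have hx : (y i + φ k * (BoundedContinuousFunction.const ℝ (-s * R i) - y i)) x =
        (1 - φ k x) * y i x - φ k x * (s * R i) := by
      simp
      ring
    rw [hx, Real.norm_eq_abs, abs_le]
    rw [abs_le] at hy hsR
    constructor <;> nlinarith
  · obtain ⟨hp1, hpδ⟩ := hp k
    have hx : (∑ i, t i • (y i + φ k * (BoundedContinuousFunction.const ℝ (-s * R i) - y i))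
        - y₀) (p k) = -s * ∑ i, t i * R i - y₀ (p k) := by
      simp only [BoundedContinuousFunction.sub_apply, BoundedContinuousFunction.sum_apply,
        BoundedContinuousFunction.smul_apply, BoundedContinuousFunction.add_apply,
        BoundedContinuousFunction.mul_apply, BoundedContinuousFunction.const_apply, hp1,
        smul_eq_mul, Finset.mul_sum]
      congr 1
      exact Finset.sum_congr rfl fun i _ => by ring
    refine le_trans ?_ (BoundedContinuousFunction.norm_coe_le_norm _ (p k))
    rw [hx]
    have hclose : |y₀ (p k) - y₀ τ| < ε / 2 := hδy hpδ
    have hsc : |s * (y₀ (p k) - y₀ τ)| < ε / 2 := by rwa [abs_mul, hs, one_mul]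
    have hss : s * s = 1 := by rw [← abs_mul_abs_self, hs, one_mul]
    calc ‖y₀‖ + ∑ i, t i * R i - ε ≤ s * s * ∑ i, t i * R i + s * y₀ (p k) := by
          rw [hss]
          linarith [(abs_lt.1 hsc).1]
      _ ≤ |-s * (-s * ∑ i, t i * R i - y₀ (p k))| := by
          refine le_trans (le_of_eq ?_) (le_abs_self _)
          ring
      _ = ‖-s * ∑ i, t i * R i - y₀ (p k)‖ := by
          rw [abs_mul, abs_neg, hs, one_mul, Real.norm_eq_abs]

/-! ### Slices, weakly open sets and comparison of the indices -/

section Indices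

variable {X : Type*} [NormedAddCommGroup X] [NormedSpace ℝ X]

theorem IsRelWeaklyOpen.subset_closedBall {W : Set X} (hW : IsRelWeaklyOpen W) :
    W ⊆ Metric.closedBall 0 1 := by
  obtain ⟨V, -, rfl⟩ := hW
  exact fun x hx => hx.1

theorem IsRelWeaklyOpen.eventually_mem {W : Set X} (hW : IsRelWeaklyOpen W) {w : X} (hw : w ∈ W)
    {u : ℕ → X} (hu : ∀ k, ‖u k‖ ≤ 1)
    (huw : ∀ f : StrongDual ℝ X, Tendsto (fun k => f (u k)) atTop (𝓝 (f w))) :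
    ∀ᶠ k in atTop, u k ∈ W := by
  obtain ⟨V, hV, rfl⟩ := hW
  have hweak : Tendsto (fun k => toWeakSpace ℝ X (u k)) atTop (𝓝 (toWeakSpace ℝ X w)) := by
    have hind : IsInducing fun (x : WeakSpace ℝ X) (f : StrongDual ℝ X) =>
        (topDualPairing ℝ X).flip x f := ⟨rfl⟩
    rw [hind.tendsto_nhds_iff, tendsto_pi_nhds]
    exact huw
  filter_upwards [hweak (hV.mem_nhds hw.2)] with k hk
  exact ⟨by simpa using hu k, hk⟩

theorem IsSlice.isRelWeaklyOpen {S : Set X} (hS : IsSlice S) : IsRelWeaklyOpen S := by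
  obtain ⟨f, α, -, -, rfl⟩ := hS
  exact ⟨{x | 1 - α < (topDualPairing ℝ X).flip x f},
    isOpen_lt continuous_const (WeakBilin.eval_continuous _ f), rfl⟩

theorem IsSlice.nonempty {S : Set X} (hS : IsSlice S) : S.Nonempty := by
  obtain ⟨f, α, hf, hα, rfl⟩ := hS
  by_contra! h
  have hle : ‖f‖ ≤ max (1 - α) 0 := by
    refine f.opNorm_le_of_unit_norm (le_max_right _ _) fun x hx => ?_
    have key : ∀ z : X, ‖z‖ = 1 → f z ≤ 1 - α := fun z hz => by
      by_contra! hlt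
      exact Set.eq_empty_iff_forall_notMem.1 h z ⟨by simp [hz], hlt⟩
    refine le_max_of_le_left (abs_le'.2 ⟨key x hx, ?_⟩)
    simpa using key (-x) (by simpa using hx)
  rw [hf] at hle
  rcases le_max_iff.1 hle with h | h <;> linarith

theorem IsRelWeaklyOpen.isConvexCombRelWeaklyOpen {W : Set X} (hW : IsRelWeaklyOpen W) :
    IsConvexCombRelWeaklyOpen W := by
  refine ⟨1, fun _ => 1, fun _ => W, fun _ => zero_le_one, by simp, fun _ => hW, ?_⟩
  ext y
  constructor
  · exact fun hy => ⟨fun _ => y, fun _ => hy, by simp⟩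
  · rintro ⟨w, hw, rfl⟩
    simpa using hw 0

/-- The three Daugavet indices agree as soon as an upper bound for the slice index matches a lower
bound for the convex combination index. -/
theorem daugavetIndices_eq {r : ℝ} (hr : 0 ≤ r)
    (hup : ∀ ε > 0, ∃ x ∈ Metric.sphere (0 : X) 1, ∃ S : Set X,
      IsSlice S ∧ S ⊆ Metric.closedBall x (r + ε))
    (hlow : ∀ ρ, ∀ x ∈ Metric.sphere (0 : X) 1, ∀ C : Set X, IsConvexCombRelWeaklyOpen C →
      C.Nonempty → C ⊆ Metric.closedBall x ρ → r ≤ ρ) :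
    daugavetIndexSlice X = r ∧ daugavetIndex X = r ∧ daugavetIndexConvComb X = r := by
  have key : ∀ A : Set ℝ, (∀ ρ ∈ A, r ≤ ρ) → (∀ ε > 0, r + ε ∈ A) → sInf A = r := fun A h1 h2 =>
    IsGLB.csInf_eq ⟨h1, fun b hb => le_of_forall_pos_le_add fun ε hε => hb (h2 ε hε)⟩
      ⟨_, h2 1 one_pos⟩
  refine ⟨key _ ?_ ?_, key _ ?_ ?_, key _ ?_ ?_⟩
  · rintro ρ ⟨-, x, hx, S, hS, hSρ⟩
    exact hlow ρ x hx S hS.isRelWeaklyOpen.isConvexCombRelWeaklyOpen hS.nonempty hSρ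
  · intro ε hε
    exact ⟨by positivity, hup ε hε⟩
  · rintro ρ ⟨-, x, hx, W, hW, hne, hWρ⟩
    exact hlow ρ x hx W hW.isConvexCombRelWeaklyOpen hne hWρ
  · intro ε hε
    obtain ⟨x, hx, S, hS, hSρ⟩ := hup ε hε
    exact ⟨by positivity, x, hx, S, hS.isRelWeaklyOpen, hS.nonempty, hSρ⟩
  · rintro ρ ⟨-, x, hx, C, hC, hne, hCρ⟩
    exact hlow ρ x hx C hC hne hCρ
  · intro ε hε
    obtain ⟨x, hx, S, hS, hSρ⟩ := hup ε hε
    exact ⟨by positivity, x, hx, S, hS.isRelWeaklyOpen.isConvexCombRelWeaklyOpen, hS.nonempty, hSρ⟩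

end Indices

/-- A convex combination of relatively weakly open sets that lies in a ball stays there when its
points are perturbed along weakly convergent sequences in the unit ball. -/
theorem exists_norm_sum_sub_le {X : Type*} [NormedAddCommGroup X] [NormedSpace ℝ X] {n : ℕ}
    {t : Fin n → ℝ} {W : Fin n → Set X} (hW : ∀ i, IsRelWeaklyOpen (W i)) {x : X} {ρ : ℝ}
    (hρ : {y : X | ∃ w : Fin n → X, (∀ i, w i ∈ W i) ∧ y = ∑ i, t i • w i} ⊆
      Metric.closedBall x ρ)
    {w : Fin n → X} (hw : ∀ i, w i ∈ W i) {u : ℕ → Fin n → X} (hu : ∀ k i, ‖u k i‖ ≤ 1)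
    (huw : ∀ i (f : StrongDual ℝ X), Tendsto (fun k => f (u k i)) atTop (𝓝 (f (w i)))) :
    ∃ k, ‖∑ i, t i • u k i - x‖ ≤ ρ := by
  obtain ⟨k, hk⟩ := (eventually_all.2 fun i =>
    (hW i).eventually_mem (hw i) (fun k => hu k i) (huw i)).exists
  exact ⟨k, mem_closedBall_iff_norm.1 (hρ ⟨u k, hk, rfl⟩)⟩

/-! ### Weighted sums of two spaces -/

/-- The product `Y × Z` with the norm `max (‖y‖ + a * ‖z‖) (b * ‖y‖ + ‖z‖)`. -/
def WeightedSum (_a _b : unitInterval) (Y Z : Type*) : Type _ := Y × Z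

namespace WeightedSum

variable {a b : unitInterval} {Y Z : Type*} [NormedAddCommGroup Y] [NormedAddCommGroup Z]

instance : AddCommGroup (WeightedSum a b Y Z) := inferInstanceAs (AddCommGroup (Y × Z))

noncomputable instance : Norm (WeightedSum a b Y Z) where
  norm x := max (‖x.1‖ + a * ‖x.2‖) (b * ‖x.1‖ + ‖x.2‖)

theorem norm_def (x : WeightedSum a b Y Z) :
    ‖x‖ = max (‖x.1‖ + a * ‖x.2‖) (b * ‖x.1‖ + ‖x.2‖) := rfl

variable [NormedSpace ℝ Y] [NormedSpace ℝ Z]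

instance : Module ℝ (WeightedSum a b Y Z) := inferInstanceAs (Module ℝ (Y × Z))

theorem normedSpaceCore : NormedSpace.Core ℝ (WeightedSum a b Y Z) where
  norm_nonneg x := le_max_of_le_left
    (add_nonneg (norm_nonneg _) (mul_nonneg a.2.1 (norm_nonneg _)))
  norm_smul c x := by
    have h1 : ‖(c • x).1‖ = ‖c‖ * ‖x.1‖ := norm_smul c x.1
    have h2 : ‖(c • x).2‖ = ‖c‖ * ‖x.2‖ := norm_smul c x.2
    rw [norm_def, norm_def, h1, h2, mul_max_of_nonneg _ _ (norm_nonneg c)]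
    congr 1 <;> ring
  norm_triangle x y := by
    have h1 : ‖(x + y).1‖ ≤ ‖x.1‖ + ‖y.1‖ := norm_add_le x.1 y.1
    have h2 : ‖(x + y).2‖ ≤ ‖x.2‖ + ‖y.2‖ := norm_add_le x.2 y.2
    have h3 := mul_le_mul_of_nonneg_left h2 a.2.1
    have h4 := mul_le_mul_of_nonneg_left h1 b.2.1
    rw [norm_def, norm_def, norm_def]
    refine (max_le_max ?_ ?_).trans max_add_add_le_max_add_max
    · linarith
    · linarith
  norm_eq_zero_iff x := by
    constructor
    · intro h
      rw [norm_def] at h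
      have h1 := (le_max_left _ _).trans h.le
      have h2 := (le_max_right _ _).trans h.le
      have h3 := mul_nonneg a.2.1 (norm_nonneg x.2)
      have h4 := mul_nonneg b.2.1 (norm_nonneg x.1)
      exact Prod.ext (norm_le_zero_iff.1 (by linarith)) (norm_le_zero_iff.1 (by linarith))
    · rintro rfl
      have h1 : ‖(0 : WeightedSum a b Y Z).1‖ = 0 := norm_zero (E := Y)
      have h2 : ‖(0 : WeightedSum a b Y Z).2‖ = 0 := norm_zero (E := Z)
      rw [norm_def, h1, h2]
      simp

noncomputable instance : NormedAddCommGroup (WeightedSum a b Y Z) :=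
  NormedAddCommGroup.ofCore normedSpaceCore

noncomputable instance : NormedSpace ℝ (WeightedSum a b Y Z) := NormedSpace.ofCore normedSpaceCore

/-- The identity map as an isomorphism onto the usual product. -/
noncomputable def equivProd (a b : unitInterval) (Y Z : Type*) [NormedAddCommGroup Y]
    [NormedSpace ℝ Y] [NormedAddCommGroup Z] [NormedSpace ℝ Z] :
    WeightedSum a b Y Z ≃L[ℝ] Y × Z :=
  LinearEquiv.toContinuousLinearEquivOfBounds
    (LinearEquiv.refl ℝ (Y × Z) : WeightedSum a b Y Z ≃ₗ[ℝ] Y × Z) 1 2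
    (fun x => by
      rw [one_mul]
      refine max_le_max ?_ ?_
      · exact le_add_of_nonneg_right (mul_nonneg a.2.1 (norm_nonneg _))
      · exact le_add_of_nonneg_left (mul_nonneg b.2.1 (norm_nonneg _)))
    (fun x => by
      change max (‖x.1‖ + a * ‖x.2‖) (b * ‖x.1‖ + ‖x.2‖) ≤ 2 * ‖x‖
      have h1 : ‖x.1‖ ≤ ‖x‖ := norm_fst_le x
      have h2 : ‖x.2‖ ≤ ‖x‖ := norm_snd_le x
      have h3 := mul_le_of_le_one_left (norm_nonneg x.2) a.2.2
      have h4 := mul_le_of_le_one_left (norm_nonneg x.1) b.2.2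
      exact max_le (by linarith) (by linarith))

theorem norm_equivProd_symm (y : Y) (z : Z) :
    ‖(equivProd a b Y Z).symm (y, z)‖ = max (‖y‖ + a * ‖z‖) (b * ‖y‖ + ‖z‖) := rfl

theorem norm_eq_max (x : WeightedSum a b Y Z) : ‖x‖ =
    max (‖(equivProd a b Y Z x).1‖ + a * ‖(equivProd a b Y Z x).2‖)
      (b * ‖(equivProd a b Y Z x).1‖ + ‖(equivProd a b Y Z x).2‖) := rfl

instance [CompleteSpace Y] [CompleteSpace Z] : CompleteSpace (WeightedSum a b Y Z) :=
  (completeSpace_congr (e := (equivProd a b Y Z).toEquiv)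
    (equivProd a b Y Z).isUniformEmbedding).2 inferInstance

instance [Nontrivial Y] : Nontrivial (WeightedSum a b Y Z) :=
  inferInstanceAs (Nontrivial (Y × Z))

theorem tendsto_apply {y : ℕ → Y} {z : ℕ → Z} {x : WeightedSum a b Y Z}
    (hy : ∀ f : StrongDual ℝ Y, Tendsto (fun k => f (y k)) atTop (𝓝 (f (equivProd a b Y Z x).1)))
    (hz : ∀ f : StrongDual ℝ Z, Tendsto (fun k => f (z k)) atTop (𝓝 (f (equivProd a b Y Z x).2)))
    (f : StrongDual ℝ (WeightedSum a b Y Z)) :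
    Tendsto (fun k => f ((equivProd a b Y Z).symm (y k, z k))) atTop (𝓝 (f x)) := by
  have h : ∀ y z, f ((equivProd a b Y Z).symm (y, z)) =
      (f.comp ((equivProd a b Y Z).symm.toContinuousLinearMap.comp
        (ContinuousLinearMap.inl ℝ Y Z))) y +
      (f.comp ((equivProd a b Y Z).symm.toContinuousLinearMap.comp
        (ContinuousLinearMap.inr ℝ Y Z))) z := fun y z => by
    simp [← map_add]
  have hx : f x = f ((equivProd a b Y Z).symm
      ((equivProd a b Y Z x).1, (equivProd a b Y Z x).2)) := rfl
  rw [hx]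
  simp only [h]
  exact (hy _).add (hz _)

theorem sum_smul_symm_sub {ι : Type*} [Fintype ι] (t : ι → ℝ) (y : ι → Y) (z : ι → Z)
    (x : WeightedSum a b Y Z) :
    ∑ i, t i • (equivProd a b Y Z).symm (y i, z i) - x =
      (equivProd a b Y Z).symm (∑ i, t i • y i - (equivProd a b Y Z x).1,
        ∑ i, t i • z i - (equivProd a b Y Z x).2) := by
  apply (equivProd a b Y Z).injective
  rw [ContinuousLinearEquiv.apply_symm_apply]
  ext <;> simp [Prod.fst_sum, Prod.snd_sum]

/-- The projection to `Z` is a contraction, and `a ≤ 1` gives `(0, z₁)` norm one, so `g` keeps norm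
one on the sum. -/
theorem isSlice_snd (g : StrongDual ℝ Z) (hg : ∀ z, |g z| ≤ ‖z‖) {z₁ : Z} (hz₁ : ‖z₁‖ = 1)
    (hgz₁ : g z₁ = 1) {α : ℝ} (hα : 0 < α) :
    IsSlice {x : WeightedSum a b Y Z | x ∈ Metric.closedBall 0 1 ∧
      1 - α < g (equivProd a b Y Z x).2} := by
  set f : StrongDual ℝ (WeightedSum a b Y Z) :=
    (g.comp (ContinuousLinearMap.snd ℝ Y Z)).comp (equivProd a b Y Z).toContinuousLinearMap
  refine ⟨f, α, le_antisymm ?_ ?_, hα, rfl⟩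
  · refine f.opNorm_le_bound zero_le_one fun x => ?_
    rw [one_mul, norm_eq_max]
    refine (hg _).trans (le_max_of_le_right ?_)
    exact le_add_of_nonneg_left (mul_nonneg b.2.1 (norm_nonneg _))
  · have h := f.le_opNorm ((equivProd a b Y Z).symm (0, z₁))
    have hf : f ((equivProd a b Y Z).symm (0, z₁)) = 1 := hgz₁
    rw [hf, norm_equivProd_symm, hz₁] at h
    simpa [a.2.2] using h

end WeightedSum

open WeightedSum

/-! ### Computation of the indices -/

/-- With a one-dimensional second summand, the indices range over `[0, 1]`. -/
theorem daugavetIndices_weightedSum_real (c : unitInterval) :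
    daugavetIndexSlice (WeightedSum (unitInterval.symm c) 0 (ℝ →ᵇ ℝ) ℝ) = c ∧
    daugavetIndex (WeightedSum (unitInterval.symm c) 0 (ℝ →ᵇ ℝ) ℝ) = c ∧
    daugavetIndexConvComb (WeightedSum (unitInterval.symm c) 0 (ℝ →ᵇ ℝ) ℝ) = c := by
  have hc0 : (0 : ℝ) ≤ c := c.2.1
  have hc1 : (c : ℝ) ≤ 1 := c.2.2
  set E := equivProd (unitInterval.symm c) 0 (ℝ →ᵇ ℝ) ℝ with hE
  refine daugavetIndices_eq hc0 (fun ε hε => ?_) ?_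
  · refine ⟨E.symm (0, 1), ?_, _,
      isSlice_snd (ContinuousLinearMap.id ℝ ℝ) (fun z => le_rfl) (norm_one) rfl
        (half_pos hε), ?_⟩
    · rw [mem_sphere_zero_iff_norm, norm_equivProd_symm]
      simp [hc0]
    · rintro x ⟨hx, hx1⟩
      rw [mem_closedBall_zero_iff, norm_eq_max, ← hE] at hx
      obtain ⟨⟨y, z⟩, rfl⟩ := E.symm.surjective x
      rw [← hE] at hx1
      simp only [E.apply_symm_apply, ContinuousLinearMap.id_apply, unitInterval.coe_symm_eq,
        Set.Icc.coe_zero, zero_mul, zero_add, max_le_iff, Real.norm_eq_abs] at hx hx1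
      obtain ⟨hx2, hx3⟩ := hx
      have hz := abs_le.1 hx3
      have hz1 : |z - 1| ≤ ε / 2 := abs_le.2 ⟨by linarith, by linarith⟩
      have hz2 : 1 - ε / 2 < |z| := hx1.trans_le (le_abs_self z)
      rw [mem_closedBall_iff_norm, ← map_sub, Prod.mk_sub_mk, norm_equivProd_symm]
      simp only [unitInterval.coe_symm_eq, Set.Icc.coe_zero, zero_mul, zero_add, sub_zero,
        Real.norm_eq_abs]
      refine max_le ?_ ?_ <;> nlinarith
  · rintro ρ x - C ⟨n, t, W, ht, ht1, hW, rfl⟩ ⟨-, w, hw, rfl⟩ hρ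
    refine le_of_forall_pos_le_add fun ε hε => ?_
    -- Radius `c` is always admissible because `|z| ≤ 1` gives `c + (1 - c)|z| ≤ 1`.
    obtain ⟨u, hu, huR, hu'⟩ := exists_seq_tendsto_le_norm_sub t (fun i => (E (w i)).1)
      (fun i => max ‖(E (w i)).1‖ c) (fun i => le_max_left _ _) (E x).1 hε
    have hE1 : ∀ k i, ‖E.symm (u k i, (E (w i)).2)‖ ≤ 1 := fun k i => by
      have hwi := (hW i).subset_closedBall (hw i)
      rw [mem_closedBall_zero_iff, norm_eq_max, ← hE] at hwi
      rw [norm_equivProd_symm]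
      simp only [unitInterval.coe_symm_eq, Set.Icc.coe_zero, zero_mul, zero_add,
        max_le_iff] at hwi ⊢
      obtain ⟨h1, h2⟩ := hwi
      refine ⟨?_, h2⟩
      have h3 := huR k i
      rcases le_max_iff.1 h3 with h | h
      · linarith
      · nlinarith
    obtain ⟨k, hk⟩ := exists_norm_sum_sub_le hW hρ hw
      (u := fun k i => E.symm (u k i, (E (w i)).2)) hE1
      (fun i => tendsto_apply (hu i) fun _ => tendsto_const_nhds)
    rw [sum_smul_symm_sub, norm_equivProd_symm] at hk
    have hsum : (c : ℝ) ≤ ∑ i, t i * max ‖(E (w i)).1‖ c := by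
      calc (c : ℝ) = ∑ i, t i * (c : ℝ) := by rw [← Finset.sum_mul, ht1, one_mul]
        _ ≤ _ := Finset.sum_le_sum fun i _ =>
          mul_le_mul_of_nonneg_left (le_max_right _ _) (ht i)
    have h1 := (le_add_of_nonneg_right (mul_nonneg (unitInterval.symm c).2.1
      (norm_nonneg _))).trans ((le_max_left _ _).trans hk)
    have h2 := hu' k
    have h3 := norm_nonneg (E x).1
    linarith

/-- With equal weights and two copies of `ℝ →ᵇ ℝ`, the indices range over `(1, 2]`. -/
theorem daugavetIndices_weightedSum_self (κ : unitInterval) (hκ : 0 < (κ : ℝ)) :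
    daugavetIndexSlice (WeightedSum κ κ (ℝ →ᵇ ℝ) (ℝ →ᵇ ℝ)) = 1 + κ ∧
    daugavetIndex (WeightedSum κ κ (ℝ →ᵇ ℝ) (ℝ →ᵇ ℝ)) = 1 + κ ∧
    daugavetIndexConvComb (WeightedSum κ κ (ℝ →ᵇ ℝ) (ℝ →ᵇ ℝ)) = 1 + κ := by
  have hκ1 : (κ : ℝ) ≤ 1 := κ.2.2
  set E := equivProd κ κ (ℝ →ᵇ ℝ) (ℝ →ᵇ ℝ) with hE
  refine daugavetIndices_eq (by positivity) (fun ε hε => ?_) ?_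
  · refine ⟨E.symm (1, 0), ?_, _,
      isSlice_snd (z₁ := 1) (BoundedContinuousFunction.evalCLM ℝ (0 : ℝ))
        (fun z => z.norm_coe_le_norm 0) norm_one rfl (mul_pos hκ hε), ?_⟩
    · rw [mem_sphere_zero_iff_norm, norm_equivProd_symm]
      simp [hκ1]
    · rintro x ⟨hx, hx1⟩
      rw [mem_closedBall_zero_iff, norm_eq_max, ← hE] at hx
      obtain ⟨⟨y, z⟩, rfl⟩ := E.symm.surjective x
      rw [← hE] at hx1
      simp only [E.apply_symm_apply, BoundedContinuousFunction.evalCLM_apply,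
        max_le_iff] at hx hx1
      obtain ⟨hx2, hx3⟩ := hx
      have hz : 1 - κ * ε < ‖z‖ := hx1.trans_le ((le_abs_self _).trans (z.norm_coe_le_norm 0))
      have hy : ‖y‖ ≤ ε := le_of_mul_le_mul_left (by linarith) hκ
      have hz1 : ‖z‖ ≤ 1 := by nlinarith [norm_nonneg y]
      have hy1 : ‖y - 1‖ ≤ ε + 1 := (norm_sub_le _ _).trans (by rw [norm_one]; linarith)
      rw [mem_closedBall_iff_norm, ← map_sub, Prod.mk_sub_mk, norm_equivProd_symm, sub_zero]
      refine max_le ?_ ?_ <;> nlinarith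
  · rintro ρ x hx C ⟨n, t, W, ht, ht1, hW, rfl⟩ ⟨-, w, hw, rfl⟩ hρ
    refine le_of_forall_pos_le_add fun ε hε => ?_
    have hε2 := half_pos hε
    -- Enlarging only the first radius to `1 - ‖z‖` brings the sum of the radii to at least `1`
    -- without leaving the unit ball, as `κ ≤ 1`.
    obtain ⟨u, hu, huR, hu'⟩ := exists_seq_tendsto_le_norm_sub t (fun i => (E (w i)).1)
      (fun i => max ‖(E (w i)).1‖ (1 - ‖(E (w i)).2‖)) (fun i => le_max_left _ _) (E x).1 hε2
    obtain ⟨v, hv, hvR, hv'⟩ := exists_seq_tendsto_le_norm_sub t (fun i => (E (w i)).2)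
      (fun i => ‖(E (w i)).2‖) (fun i => le_rfl) (E x).2 hε2
    have hE1 : ∀ k i, ‖E.symm (u k i, v k i)‖ ≤ 1 := fun k i => by
      have hwi := (hW i).subset_closedBall (hw i)
      rw [mem_closedBall_zero_iff, norm_eq_max, ← hE, max_le_iff] at hwi
      obtain ⟨h1, h2⟩ := hwi
      rw [norm_equivProd_symm]
      have h3 := hvR k i
      have h4 := norm_nonneg (v k i)
      rcases le_max_iff.1 (huR k i) with h | h
      · refine max_le ?_ ?_ <;> nlinarith
      · refine max_le ?_ ?_ <;> nlinarith [norm_nonneg (u k i)]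
    obtain ⟨k, hk⟩ := exists_norm_sum_sub_le hW hρ hw
      (u := fun k i => E.symm (u k i, v k i)) hE1 (fun i => tendsto_apply (hu i) (hv i))
    rw [sum_smul_symm_sub, norm_equivProd_symm, max_le_iff] at hk
    have hsum : 1 ≤ ∑ i, t i * max ‖(E (w i)).1‖ (1 - ‖(E (w i)).2‖) +
        ∑ i, t i * ‖(E (w i)).2‖ := by
      rw [← Finset.sum_add_distrib]
      refine ht1.symm.le.trans (Finset.sum_le_sum fun i _ => ?_)
      rw [← mul_add]
      exact le_mul_of_one_le_right (ht i) (by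
        linarith [le_max_right ‖(E (w i)).1‖ (1 - ‖(E (w i)).2‖)])
    have hx1 : 1 ≤ ‖(E x).1‖ + ‖(E x).2‖ := by
      rw [mem_sphere_zero_iff_norm, norm_eq_max, ← hE] at hx
      rw [← hx]
      have h3 := mul_le_of_le_one_left (norm_nonneg (E x).2) hκ1
      have h4 := mul_le_of_le_one_left (norm_nonneg (E x).1) hκ1
      exact max_le (by linarith) (by linarith)
    have h1 := hu' k
    have h2 := hv' k
    obtain ⟨h3, h4⟩ := hk
    have h5 : 2 - ε ≤ ‖∑ i, t i • u k i - (E x).1‖ + ‖∑ i, t i • v k i - (E x).2‖ := by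
      linarith
    -- Adding `h3` and `h4` gives `(1 + κ)(2 - ε) ≤ 2ρ`, and `(1 + κ) / 2 ≤ 1` absorbs the error.
    nlinarith

theorem theorem2p6 (r : ℝ) (hr : r ∈ Set.Icc (0 : ℝ) 2) :
    ∃ (X : Type) (_ : NormedAddCommGroup X) (_ : NormedSpace ℝ X),
      CompleteSpace X ∧ Nontrivial X ∧
      daugavetIndexSlice X = r ∧ daugavetIndex X = r ∧ daugavetIndexConvComb X = r := by
  have : Nontrivial (ℝ →ᵇ ℝ) := NormOneClass.nontrivial
  rcases le_or_gt r 1 with h | h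
  · exact ⟨_, _, _, inferInstance, inferInstance, daugavetIndices_weightedSum_real ⟨r, hr.1, h⟩⟩
  · have := daugavetIndices_weightedSum_self ⟨r - 1, by linarith, by linarith [hr.2]⟩
      (sub_pos.2 h)
    simp only [add_sub_cancel] at this
    exact ⟨_, _, _, inferInstance, inferInstance, this⟩
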